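/- **Conventions.** Let $d$ be a cardinal with $2\le d\le\omega$, identified with $\{n\in\omega : n<d\}$ and given the discrete topology; $d^\omega$, $(d^\omega)^d$, $2^\omega$ and $\omega^\omega$ carry the product topologies, and $\omega-1:=\omega$. Let $l\mapsto((l)_0,(l)_1)$ be the bijection from $\omega$ onto $\omega^2$ inverse to $\langle n,p\rangle:=\big(\sum_{k\le n+p}k\big)+p$. For a nonempty finite sequence $u$ of integers, define $p(u)\in\omega$ by $p(u):=u(0)$ if $|u|=1$, and $p(um):=\langle p(u),m\rangle$ if $u\neq\emptyset$ and $m\in\omega$. An *effective frame* is a set $E=\{(s^l_i)_{i\in d} : l\in\omega\}$, where $s^l_i\in d^l$ for all $l\in\omega$ and $i\in d$, such that - for all $p,q,r\in\omega$ and $t\in d^{<\omega}$ there is $N\in\omega$ with $(s^q_i\,i\,t\,0^N)_{i\in d}\in E$, $(|s^q_0\,0\,t\,0^N|-1)_0=p$ and $((|s^q_0\,0\,t\,0^N|-1)_1)_0=r$; - for each $l>0$ there are $q<l$ and $t\in d^{<\omega}$ with $s^l_i=s^q_i\,i\,t$ for all $i\in d$; - the map $(l,i)\mapsto s^l_i$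 is recursive. The associated tree $T_d$ consists of the families $(s_i)_{i\in d}$ of elements of $d^{<\omega}$ such that either $s_i=\emptyset$ for all $i\in d$, or there are $l\in\omega$ and $t\in d^{<\omega}$ with $s_i=s^l_i\,i\,t$ for all $i\in d$, and $s_0(n)\le n$ for all $n<|s_0|$. Its body $[T_d]$ is the set of $\vec\alpha\in(d^\omega)^d$ with $(\alpha_i|n)_{i\in d}\in T_d$ for each $n\in\omega$. For sets $A\subseteq X$ and $B\subseteq Y$ in topological spaces, $(X,A)\le_W(Y,B)$ means that $A=f^{-1}(B)$ for some continuous $f:X\to Y$. A class $\Gamma$ of subsets of zero-dimensional Polish spaces is a *Wadge class of Borel sets* if there is a Borel set $A_0\subseteq\omega^\omega$ such that, for all zero-dimensional Polish $X$ and $A\subseteq X$, $A\in\Gamma(X)$ if and only if $(X,A)\le_W(\omega^\omega,A_0)$. Put $\check\Gamma:=\{\neg A : A\in\Gamma\}$ and $\Delta(\Gamma):=\Gamma\cap\check\Gamma$; $\Gamma$ is *self-dual* if $\Gamma=\check\Gamma$. A set $C\subseteq2^\omega$ is *$\Gamma$-complete* if $C\in\Gamma(2^\omega)$ and $(X,A)\le_W(2^\omega,C)$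 for every zero-dimensional Polish $X$ and $A\in\Gamma(X)$. A Borel set $B\subseteq\prod_{i\in d}X_i$, where the $X_i$ are Polish, is $\mathrm{pot}(\Gamma)$ if for each $i\in d$ there is a finer zero-dimensional Polish topology $\tau_i$ on $X_i$ such that $B\in\Gamma(\prod_{i\in d}(X_i,\tau_i))$. A set $P$ *separates* $A$ from $B$ if $A\subseteq P$ and $P\cap B=\emptyset$. For $\beta,\gamma\in d^\omega$, $\beta\Delta\gamma\in2^\omega$ is defined by $(\beta\Delta\gamma)(m)=1\Leftrightarrow\beta(m)\ne\gamma(m)$, and $\mathcal S(\alpha)(m):=\alpha(m+1)$ for $\alpha\in2^\omega$. A set $C\subseteq2^\omega$ is *compatible with comeager sets* (*ccs*) if, for all $\alpha_0\in d^\omega$ and $F=(F_i)_{i<d-1}:2^\omega\to(d^\omega)^{d-1}$ such that every $\alpha\in2^\omega$, with $\delta:=\alpha_0\Delta F_0(\alpha)$, satisfies - for all $u\in\omega^{<\omega}$ and $m\in\omega$: if $\alpha(p(um))=1$, then $\delta(p(um')+1)=1$ for some $m'\in\omega$; and if $\delta(p(um)+1)=1$, then $\alpha(p(um'))=1$ for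 some $m'\in\omega$; - there is an increasing bijection $B_\alpha:\{m : \alpha(m)=1\}\to\{m' : \delta(m'+1)=1\}$ with $(m)_0=(B_\alpha(m))_0$ and $((m)_1)_0=((B_\alpha(m))_1)_0$ whenever $\alpha(m)=1$, we have $\alpha\in C\Leftrightarrow\mathcal S(\alpha_0\Delta F_0(\alpha))\in C$ for all $\alpha\in2^\omega$. Put $S^d_C:=\{\vec\alpha\in[T_d] : \mathcal S(\alpha_0\Delta\alpha_1)\in C\}$. **Lemma.** Let $T_d$ be the tree associated with an effective frame, and $\Gamma$ a non-self-dual Wadge class of Borel sets. 1. Assume that $C\subseteq2^\omega$ is a $\Gamma$-complete ccs set. Then $S^d_C\in\Gamma([T_d])$, $S^d_C$ is a Borel subset of $(d^\omega)^d$, and $S^d_C$ is not separable from $[T_d]\setminus S^d_C$ by a $\mathrm{pot}(\check\Gamma)$ set. 2. Assume that $C^0,C^1\in\Gamma(2^\omega)$ are disjoint, ccs, and not separable by a $\Delta(\Gamma)$ set. Then $S^d_{C^0},S^d_{C^1}\in\Gamma([T_d])$ are disjoint Borel subsets of $(d^\omega)^d$, and they are not separable by a $\mathrm{pot}(\Delta(\Gamma))$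 set. -/

import Mathlib

namespace PotWadge

/-! ### Wadge classes -/

/-- Borel subsets of a topological space. -/
def IsBorel {X : Type} [TopologicalSpace X] (B : Set X) : Prop := @MeasurableSet X (borel X) B

/-- Zero-dimensional Polish spaces: Polish, with a basis of clopen sets. -/
def IsZeroDimPolish (X : Type) [TopologicalSpace X] : Prop :=
  PolishSpace X ∧ TopologicalSpace.IsTopologicalBasis {U : Set X | IsClopen U}

/-- A class `Γ` of subsets of spaces; `Γ X` is the family of the subsets of `X` that are in `Γ`.
Only its values on zero-dimensional Polish spaces matter. -/
abbrev PointClass : Type 1 := ∀ (X : Type) [TopologicalSpace X], Set (Set X)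

/-- The Wadge quasi-order `(X, A) ≤_W (Y, B)`. -/
def WadgeLE {X Y : Type} [TopologicalSpace X] [TopologicalSpace Y] (A : Set X) (B : Set Y) : Prop :=
  ∃ f : X → Y, Continuous f ∧ A = f ⁻¹' B

/-- `Γ` is a Wadge class of Borel sets. -/
def IsWadgeClass (Γ : PointClass) : Prop :=
  ∃ A₀ : Set (ℕ → ℕ), IsBorel A₀ ∧
    ∀ (X : Type) [TopologicalSpace X], IsZeroDimPolish X →
      ∀ A : Set X, A ∈ Γ X ↔ WadgeLE A A₀

/-- The dual class of `Γ`, whose elements are the complements of the elements of `Γ`. -/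
def dual (Γ : PointClass) : PointClass := fun X _ => {A : Set X | Aᶜ ∈ Γ X}

/-- The ambiguous class `Δ(Γ)`: the intersection of `Γ` and its dual class. -/
def ambiguous (Γ : PointClass) : PointClass := fun X _ => Γ X ∩ dual Γ X

/-- `Γ` is self-dual. -/
def IsSelfDual (Γ : PointClass) : Prop :=
  ∀ (X : Type) [TopologicalSpace X], IsZeroDimPolish X → Γ X = dual Γ X

/-- `C ⊆ Y` is `Γ`-complete: it is in `Γ`, and every set in `Γ` continuously reduces to it. -/
def IsCompleteFor (Γ : PointClass) {Y : Type} [TopologicalSpace Y] (C : Set Y) : Prop :=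
  C ∈ Γ Y ∧ ∀ (X : Type) [TopologicalSpace X], IsZeroDimPolish X → ∀ A ∈ Γ X, WadgeLE A C

/-- `B ⊆ ∏ i, X i` is potentially in `Γ`: it is Borel, and it is in `Γ` for the product of some
zero-dimensional Polish topologies `τ i`, each finer than the given topology of `X i`. -/
def IsPot (Γ : PointClass) {ι : Type} {X : ι → Type} [t : ∀ i, TopologicalSpace (X i)]
    (B : Set (∀ i, X i)) : Prop :=
  IsBorel B ∧
    ∃ τ : ∀ i, TopologicalSpace (X i),
      (∀ i, τ i ≤ t i ∧ @IsZeroDimPolish (X i) (τ i)) ∧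
        B ∈ @Γ (∀ i, X i) (@Pi.topologicalSpace ι X τ)

/-- `P` separates `A` from `B`. -/
def Separates {X : Type} (P A B : Set X) : Prop := A ⊆ P ∧ Disjoint P B

/-! ### The bijection between `ω` and `ω²` -/

/-- The sum of the integers `k ≤ m`. -/
def triangle (m : ℕ) : ℕ := ∑ k ∈ Finset.range (m + 1), k

/-- The largest `m` whose `triangle` is at most `l` (such an `m` is at most `l`). -/
def bigM (l : ℕ) : ℕ := Nat.findGreatest (fun m => triangle m ≤ l) l

/-- The first coordinate `(l)₀`. -/
def fstCoord (l : ℕ) : ℕ := bigM l + triangle (bigM l) - l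

/-- The second coordinate `(l)₁`. -/
def sndCoord (l : ℕ) : ℕ := l - triangle (bigM l)

/-- The code `⟨n, p⟩` of a pair, inverse to `l ↦ ((l)₀, (l)₁)`. -/
def pairCode (n p : ℕ) : ℕ := triangle (n + p) + p

/-- The code of a nonempty finite sequence of integers: the code of `(a)` is `a`, and the code of
`u` followed by `m` is `⟨code of u, m⟩` if `u` is nonempty. (The value at `[]` is irrelevant.) -/
def seqCode : List ℕ → ℕ
  | [] => 0
  | a :: u => u.foldl pairCode a

/-! ### The index set `d`, frames and their trees -/

/-- The cardinal `d ≤ ω`, as the set of the integers smaller than `d`, with the discrete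
topology. -/
abbrev Idx (d : ℕ∞) : Type := {n : ℕ // (n : ℕ∞) < d}

/-- The element `0` of `d`. -/
def Idx.zero {d : ℕ∞} (h : 0 < d) : Idx d := ⟨0, by simpa using h⟩

/-- The element `1` of `d`. -/
def Idx.one {d : ℕ∞} (h : 1 < d) : Idx d := ⟨1, by simpa using h⟩

theorem zero_lt {d : ℕ∞} (hd : 2 ≤ d) : 0 < d := lt_of_lt_of_le (by norm_num) hd

theorem one_lt {d : ℕ∞} (hd : 2 ≤ d) : 1 < d := lt_of_lt_of_le (by norm_num) hd

theorem zero_lt_sub_one {d : ℕ∞} (hd : 2 ≤ d) : 0 < d - 1 := tsub_pos_of_lt (one_lt hd)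

/-- The space `d^ω`. -/
abbrev Seqs (d : ℕ∞) : Type := ℕ → Idx d

/-- The family `l ↦ (s l i)_{i ∈ d}` enumerates an effective frame: the frame is
`E = {(s l i)_{i ∈ d} | l ∈ ω}`, and `s l` is its only element whose coordinates have length `l`. -/
structure IsEffectiveFrame {d : ℕ∞} (hd : 2 ≤ d) (s : ℕ → Idx d → List (Idx d)) : Prop where
  length_eq : ∀ l i, (s l i).length = l
  extend : ∀ (p q r : ℕ) (t : List (Idx d)), ∃ N : ℕ,
    (fun i => s q i ++ i :: (t ++ List.replicate N (Idx.zero (zero_lt hd)))) ∈ Set.range s ∧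
    fstCoord ((s q (Idx.zero (zero_lt hd)) ++ Idx.zero (zero_lt hd) ::
      (t ++ List.replicate N (Idx.zero (zero_lt hd)))).length - 1) = p ∧
    fstCoord (sndCoord ((s q (Idx.zero (zero_lt hd)) ++ Idx.zero (zero_lt hd) ::
      (t ++ List.replicate N (Idx.zero (zero_lt hd)))).length - 1)) = r
  pred : ∀ l > 0, ∃ q < l, ∃ t : List (Idx d), ∀ i, s l i = s q i ++ i :: t
  recursive : ∃ f : ℕ → ℕ → List ℕ, Computable₂ f ∧
    ∀ (l : ℕ) (i : Idx d), f l i = (s l i).map Subtype.val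

/-- The tree `T_d` on `d^d` associated with the frame enumerated by `s`. A finite sequence of
elements of `d^d` is seen as a family, indexed by `d`, of finite sequences of the same length. -/
def frameTree {d : ℕ∞} (hd : 2 ≤ d) (s : ℕ → Idx d → List (Idx d)) : Set (Idx d → List (Idx d)) :=
  {u | (∀ i, u i = []) ∨
    ((∃ (l : ℕ) (t : List (Idx d)), ∀ i, u i = s l i ++ i :: t) ∧
      ∀ (n : ℕ) (hn : n < (u (Idx.zero (zero_lt hd))).length),
        ((u (Idx.zero (zero_lt hd)))[n] : ℕ) ≤ n)}

/-- The set `[T]` of the infinite branches of a tree `T` on `d^d`, as a subset of `(d^ω)^d`. -/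
def branches {d : ℕ∞} (T : Set (Idx d → List (Idx d))) : Set (Idx d → Seqs d) :=
  {α | ∀ n : ℕ, (fun i => List.ofFn (fun k : Fin n => α i k)) ∈ T}

/-! ### Compatibility with comeager sets -/

/-- The symmetric difference of two sequences. -/
def symDiff {d : ℕ∞} (a b : Seqs d) : ℕ → Bool := fun m => decide (a m ≠ b m)

/-- The shift map on `2^ω`. -/
def shift (α : ℕ → Bool) : ℕ → Bool := fun m => α (m + 1)

/-- The combinatorial relation between `α ∈ 2^ω` and `δ ∈ 2^ω` that is required of the symmetric
difference `δ` of `α₀` and `F₀(α)`. The order isomorphism is an increasing bijection. -/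
def Linked (α δ : ℕ → Bool) : Prop :=
  (∀ (u : List ℕ) (m : ℕ),
    (α (seqCode (u ++ [m])) = true → ∃ m', δ (seqCode (u ++ [m']) + 1) = true) ∧
    (δ (seqCode (u ++ [m]) + 1) = true → ∃ m', α (seqCode (u ++ [m'])) = true)) ∧
  ∃ B : {m : ℕ // α m = true} ≃o {m : ℕ // δ (m + 1) = true},
    ∀ m : {m : ℕ // α m = true}, fstCoord m.1 = fstCoord (B m).1 ∧
      fstCoord (sndCoord m.1) = fstCoord (sndCoord (B m).1)

/-- `C ⊆ 2^ω` is compatible with comeager sets. The values of `F` are in `(d^ω)^(d-1)`, where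
`ω - 1 = ω`, and `F₀` is the first of its `d - 1` components. -/
def IsCcs {d : ℕ∞} (hd : 2 ≤ d) (C : Set (ℕ → Bool)) : Prop :=
  ∀ (α₀ : Seqs d) (F : (ℕ → Bool) → Idx (d - 1) → Seqs d),
    (∀ α, Linked α (symDiff α₀ (F α (Idx.zero (zero_lt_sub_one hd))))) →
      ∀ α, α ∈ C ↔ shift (symDiff α₀ (F α (Idx.zero (zero_lt_sub_one hd)))) ∈ C

/-- The set of the branches `α` of `T_d` such that the shift of the symmetric difference of `α₀`
and `α₁` is in `C`. -/
def frameSet {d : ℕ∞} (hd : 2 ≤ d) (s : ℕ → Idx d → List (Idx d)) (C : Set (ℕ → Bool)) :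
    Set (Idx d → Seqs d) :=
  {α | α ∈ branches (frameTree hd s) ∧
    shift (symDiff (α (Idx.zero (zero_lt hd))) (α (Idx.one (one_lt hd)))) ∈ C}

/-- `S ⊆ Y` is in `Γ(Y)`, where `Y` is a subset of `X` with the subspace topology. -/
def InClassOn (Γ : PointClass) {X : Type} [TopologicalSpace X] (Y S : Set X) : Prop :=
  S ⊆ Y ∧ ((Subtype.val : Y → X) ⁻¹' S) ∈ Γ Y

end PotWadge

open PotWadge

/-!
The map `α ↦ shift (symDiff (α 0) (α 1))` is continuous on the closed set `[T_d]`, so `frameSet`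
is a continuous preimage of `C`; this gives its class, and it is Borel. The substance is the
non-separability.

Suppose that `P` is in the given class for finer zero-dimensional Polish topologies `τ i`. It
suffices to find a map `F` from `2^ω` into the branches of the tree that is continuous for the
`τ i`, whose coordinate `F α 0` is a constant sequence `z`, and such that `α` is linked to
`symDiff z (F α 1)`: a ccs set `C` is then the preimage of `frameSet C` under `F`, so that the
preimage of `P` separates in `2^ω`, which contradicts the assumption on the class. (In the first
part it would be `C` itself, and a complete set in the dual class makes the class self-dual.)

A finer Polish topology has the same Borel sets. As these have the Baire property, the finer
topology agrees with the usual one on a comeager set (`exists_residual_continuous`), so it is enough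
that `F` is continuous for the usual topologies and that `F α i` meets countably many dense open
sets (`exists_dense_of_mem_residual`). Since `α 0 n ≤ n` on the tree, density is relative to the
closed set `bounded i`, not to the whole space of sequences.

All the branches `F α` are read off from one sequence `z`: the coordinate `F α i` is `z`, except
that it takes the value `i` at `0` and at certain positions, the breaks of `α` (`breakSeq`). Every
node of the binary tree (every finite binary sequence, coded by `node`) receives a position, and
`α` breaks at the positions of those of its initial segments that it prolongs by `1`. For the
family to be a branch, it must be in the frame at each break. As the frame has only one element of
each length, the nodes are treated one by one: the frame axiom allows to prolong the current prefix
by zeros up to a frame element whose length has the coordinates required by `Linked`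
(`exists_realizes_ge`), and the prefix is then prolonged so as to meet finitely many dense open
sets, for all the finitely many possible sets of breaks (`exists_forced_of_finite`). The limit of
these approximations (`Approx`) is the subject of `exists_generic`. Positions increase with the
nodes, so sending `m` to the position of the initial segment of length `m` of `α`, minus one, is
the increasing bijection that `Linked` asks for; its other conditions follow from it
(`linked_of_orderIso`).
-/

namespace PotWadge

open TopologicalSpace Filter Topology Set

/-! ### Zero-dimensional Polish spaces -/

theorem isZeroDimPolish_of_discrete {X : Type} [TopologicalSpace X] [DiscreteTopology X]
    [Countable X] : IsZeroDimPolish X :=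
  ⟨inferInstance, isTopologicalBasis_of_isOpen_of_nhds (fun _ hU => hU.isOpen)
    fun _ U ha _ => ⟨U, isClopen_discrete U, ha, Subset.rfl⟩⟩

theorem IsZeroDimPolish.pi {ι : Type} [Countable ι] {X : ι → Type}
    [t : ∀ i, TopologicalSpace (X i)] (h : ∀ i, IsZeroDimPolish (X i)) :
    IsZeroDimPolish (∀ i, X i) := by
  have := fun i => (h i).1
  refine ⟨inferInstance, isTopologicalBasis_of_isOpen_of_nhds (fun _ hU => hU.isOpen) ?_⟩
  intro a U ha hU
  obtain ⟨V, ⟨W, F, hW, rfl⟩, haV, hVU⟩ :=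
    (isTopologicalBasis_pi fun i => (h i).2).exists_subset_of_mem_open ha hU
  refine ⟨_, ⟨?_, ?_⟩, haV, hVU⟩
  · rw [Set.pi_def]
    exact isClosed_biInter fun i hi => (hW i hi).isClosed.preimage (continuous_apply i)
  · exact isOpen_set_pi F.finite_toSet fun i hi => (hW i hi).isOpen

theorem IsZeroDimPolish.subtype {X : Type} [TopologicalSpace X] (h : IsZeroDimPolish X)
    {S : Set X} (hS : IsClosed S) : IsZeroDimPolish S := by
  have := h.1
  refine ⟨hS.polishSpace, isTopologicalBasis_of_isOpen_of_nhds (fun _ hU => hU.isOpen) ?_⟩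
  rintro a _ ha ⟨U, hU, rfl⟩
  obtain ⟨V, hV, haV, hVU⟩ := h.2.exists_subset_of_mem_open ha hU
  exact ⟨Subtype.val ⁻¹' V, hV.preimage continuous_subtype_val, haV, preimage_mono hVU⟩

theorem isZeroDimPolish_cantor : IsZeroDimPolish (ℕ → Bool) :=
  IsZeroDimPolish.pi fun _ => isZeroDimPolish_of_discrete

theorem isZeroDimPolish_seqs (d : ℕ∞) : IsZeroDimPolish (Seqs d) :=
  IsZeroDimPolish.pi fun _ => isZeroDimPolish_of_discrete

/-! ### Comeager sets and finer topologies -/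

/-- A finer Polish topology has the same Borel sets, so its open sets have the Baire property for
the coarser topology, and the two topologies agree on a comeager subset of any subspace. -/
theorem exists_residual_continuous {X : Type} (τ : TopologicalSpace X)
    [t : TopologicalSpace X] [PolishSpace X] (hle : τ ≤ t) (hτ : @PolishSpace X τ) (K : Set X) :
    ∃ G ∈ residual K, ∀ (Y : Type) [TopologicalSpace Y] (f : Y → X), Continuous f →
      (∀ y, f y ∈ Subtype.val '' G) → @Continuous Y X _ τ f := by
  obtain ⟨b, hbc, -, hb⟩ := @exists_countable_basis X τ hτ.toSecondCountableTopology
  have key : ∀ V ∈ b, ∃ U : Set K, IsOpen U ∧ (Subtype.val ⁻¹' V : Set K) =ᵇ U := by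
    intro V hV
    borelize X
    have hm : MeasurableSet V := by
      have : @MeasurableSet X (@borel X τ) V :=
        MeasurableSpace.measurableSet_generateFrom (@IsTopologicalBasis.isOpen X τ _ _ hb hV)
      rwa [@MeasureTheory.borel_eq_borel_of_le X τ t hτ inferInstance hle] at this
    exact (measurable_subtype_coe hm).residualEq_isOpen
  choose! U hU hVU using key
  refine ⟨{x | ∀ V ∈ b, (x ∈ (Subtype.val ⁻¹' V : Set K) ↔ x ∈ U V)}, ?_, ?_⟩
  · exact (eventually_countable_ball hbc).2 fun V hV => (hVU V hV).mem_iff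
  · intro Y _ f hf hG
    refine (@IsTopologicalBasis.continuous_iff Y X _ τ b hb f).2 fun V hV => ?_
    have hK : ∀ y, f y ∈ K := fun y => by
      obtain ⟨x, -, hx⟩ := hG y
      exact hx ▸ x.2
    have : f ⁻¹' V = (fun y => (⟨f y, hK y⟩ : K)) ⁻¹' U V := by
      ext y
      obtain ⟨x, hx, hxy⟩ := hG y
      have : (⟨f y, hK y⟩ : K) = x := Subtype.ext hxy.symm
      rw [mem_preimage, mem_preimage, this, ← hx V hV, mem_preimage, hxy]
    rw [this]
    exact (hU V hV).preimage (hf.subtype_mk hK)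

/-- Any point of `K` can be modified beyond any `n` so that a finite prefix forces it into `U`. -/
def PrefixDense {D : Type} (K U : Set (ℕ → D)) : Prop :=
  ∀ β ∈ K, ∀ n, ∃ β' ∈ K, (∀ m < n, β' m = β m) ∧
    ∃ n' ≥ n, ∀ γ ∈ K, (∀ m < n', γ m = β' m) → γ ∈ U

/-- A comeager subset of a set `K` of sequences in terms of finite approximations: it contains the
intersection of a sequence of prefix-dense sets. -/
theorem exists_dense_of_mem_residual {D : Type} [TopologicalSpace D] [DiscreteTopology D]
    {K : Set (ℕ → D)} {G : Set K} (hG : G ∈ residual K) :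
    ∃ O : ℕ → Set (ℕ → D),
      (∀ k, PrefixDense K (O k)) ∧ ∀ β ∈ K, (∀ k, β ∈ O k) → β ∈ Subtype.val '' G := by
  obtain ⟨S, hSo, hSd, hSc, hSG⟩ := mem_residual_iff.1 hG
  -- `univ` is added to `S` since `S` may be empty
  obtain ⟨g, hg⟩ := (hSc.insert univ).exists_eq_range (insert_nonempty _ _)
  have hgo : ∀ k, IsOpen (g k) ∧ Dense (g k) := by
    intro k
    have : g k ∈ insert univ S := hg ▸ mem_range_self k
    rcases this with h | h
    · rw [h]; exact ⟨isOpen_univ, dense_univ⟩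
    · exact ⟨hSo _ h, hSd _ h⟩
  refine ⟨fun k => Subtype.val '' g k, ?_, ?_⟩
  · intro k β hβ n
    obtain ⟨⟨β', hβ'⟩, hβc, hβg⟩ := (hgo k).2.inter_open_nonempty
      (Subtype.val ⁻¹' PiNat.cylinder β n)
      ((PiNat.isOpen_cylinder (fun _ => D) β n).preimage continuous_subtype_val)
      ⟨⟨β, hβ⟩, PiNat.self_mem_cylinder β n⟩
    obtain ⟨W, hW, hWg⟩ := isOpen_induced_iff.1 (hgo k).1
    have hβW : β' ∈ W := by
      have : (⟨β', hβ'⟩ : K) ∈ Subtype.val ⁻¹' W := hWg ▸ hβg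
      exact this
    obtain ⟨_, ⟨x, N, rfl⟩, hx, hxW⟩ :=
      (PiNat.isTopologicalBasis_cylinders fun _ => D).exists_subset_of_mem_open hβW hW
    refine ⟨β', hβ', hβc, max n N, le_max_left _ _, fun γ hγ h => ⟨⟨γ, hγ⟩, ?_, rfl⟩⟩
    rw [← hWg]
    refine hxW ?_
    rw [PiNat.mem_cylinder_iff] at hx ⊢
    exact fun m hm => (h m (hm.trans_le (le_max_right _ _))).trans (hx m hm)
  · intro β hβ hO
    refine ⟨⟨β, hβ⟩, hSG fun T hT => ?_, rfl⟩
    obtain ⟨k, rfl⟩ : T ∈ range g := hg ▸ mem_insert_of_mem _ hT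
    obtain ⟨x, hx, hxy⟩ := hO k
    have : (⟨β, hβ⟩ : K) = x := Subtype.ext hxy.symm
    rwa [this]

/-- A map on `2^ω` that reads finitely many coordinates is continuous. -/
theorem continuous_of_finite_dependence {Y : Type} [TopologicalSpace Y] {f : (ℕ → Bool) → Y}
    (N : ℕ) (h : ∀ α α' : ℕ → Bool, (∀ k < N, α k = α' k) → f α = f α') : Continuous f := by
  have : f = (fun a : Fin N → Bool => f fun k => if hk : k < N then a ⟨k, hk⟩ else false) ∘
      fun α k => α k := by
    funext α
    exact h _ _ fun k hk => by simp [hk]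
  rw [this]
  exact continuous_of_discreteTopology.comp (by fun_prop)

/-! ### Wadge classes -/

theorem WadgeLE.trans {X Y Z : Type} [TopologicalSpace X] [TopologicalSpace Y]
    [TopologicalSpace Z] {A : Set X} {B : Set Y} {C : Set Z} (h : WadgeLE A B)
    (h' : WadgeLE B C) : WadgeLE A C := by
  obtain ⟨f, hf, rfl⟩ := h
  obtain ⟨g, hg, rfl⟩ := h'
  exact ⟨g ∘ f, hg.comp hf, rfl⟩

theorem WadgeLE.compl {X Y : Type} [TopologicalSpace X] [TopologicalSpace Y] {A : Set X}
    {B : Set Y} (h : WadgeLE A B) : WadgeLE Aᶜ Bᶜ := by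
  obtain ⟨f, hf, rfl⟩ := h
  exact ⟨f, hf, rfl⟩

theorem IsBorel.preimage {X Y : Type} [TopologicalSpace X] [TopologicalSpace Y] {B : Set Y}
    (hB : IsBorel B) {f : X → Y} (hf : Continuous f) : IsBorel (f ⁻¹' B) := by
  borelize X Y
  exact hf.measurable hB

theorem IsWadgeClass.mem_of_wadgeLE {Γ : PointClass} (hΓ : IsWadgeClass Γ) {X Y : Type}
    [TopologicalSpace X] [TopologicalSpace Y] (hX : IsZeroDimPolish X) (hY : IsZeroDimPolish Y)
    {A : Set X} {B : Set Y} (h : WadgeLE A B) (hB : B ∈ Γ Y) : A ∈ Γ X := by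
  obtain ⟨A₀, -, hA₀⟩ := hΓ
  exact (hA₀ X hX A).2 (h.trans ((hA₀ Y hY B).1 hB))

theorem IsWadgeClass.isBorel {Γ : PointClass} (hΓ : IsWadgeClass Γ) {X : Type}
    [TopologicalSpace X] (hX : IsZeroDimPolish X) {A : Set X} (hA : A ∈ Γ X) : IsBorel A := by
  obtain ⟨A₀, hB, hA₀⟩ := hΓ
  obtain ⟨f, hf, rfl⟩ := (hA₀ X hX A).1 hA
  exact hB.preimage hf

/-- A class with a complete set whose complement is also in the class is self-dual. -/
theorem IsCompleteFor.isSelfDual {Γ : PointClass} (hΓ : IsWadgeClass Γ) {Y : Type}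
    [TopologicalSpace Y] (hY : IsZeroDimPolish Y) {C : Set Y} (hC : IsCompleteFor Γ C)
    (hC' : C ∈ dual Γ Y) : IsSelfDual Γ := by
  have key : ∀ (X : Type) [TopologicalSpace X], IsZeroDimPolish X → ∀ A ∈ Γ X, Aᶜ ∈ Γ X :=
    fun X _ hX A hA => hΓ.mem_of_wadgeLE hX hY (hC.2 X hX A hA).compl hC'
  intro X _ hX
  ext A
  exact ⟨key X hX A, fun h => compl_compl A ▸ key X hX _ h⟩

/-! ### Sequences with prescribed breaks -/

open Classical in
/-- The `i`-th coordinate of the family obtained from the common sequence `z` by replacing the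
value at `0` and at each position in `A` by `i`. The positions in `A` are called breaks. -/
noncomputable def breakSeq {d : ℕ∞} (z : Seqs d) (A : Set ℕ) (i : Idx d) : Seqs d :=
  fun n => if n = 0 ∨ n ∈ A then i else z n

/-- The element of length `l` of the frame `s` is the restriction to `l` of the family with common
sequence `z` and breaks in `A`. -/
def Realizes {d : ℕ∞} (s : ℕ → Idx d → List (Idx d)) (z : Seqs d) (A : Set ℕ) (l : ℕ) : Prop :=
  ∀ i, s l i = List.ofFn fun k : Fin l => breakSeq z A i k

theorem breakSeq_congr {d : ℕ∞} {z z' : Seqs d} {A A' : Set ℕ} {n : ℕ} (hz : z n = z' n)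
    (hA : n ∈ A ↔ n ∈ A') (i : Idx d) : breakSeq z A i n = breakSeq z' A' i n := by
  unfold breakSeq
  rw [hz]
  split_ifs <;> tauto

theorem Realizes.congr {d : ℕ∞} {s : ℕ → Idx d → List (Idx d)} {z z' : Seqs d} {A A' : Set ℕ}
    {l : ℕ} (h : Realizes s z A l) (hz : ∀ m < l, z m = z' m) (hA : ∀ m < l, m ∈ A ↔ m ∈ A') :
    Realizes s z' A' l := by
  intro i
  rw [h i]
  congr 1
  funext k
  exact breakSeq_congr (hz k k.2) (hA k k.2) i

theorem breakSeq_le {d : ℕ∞} {z : Seqs d} (hz : ∀ m, (z m : ℕ) ≤ m) (A : Set ℕ) (i : Idx d)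
    (n : ℕ) : (breakSeq z A i n : ℕ) ≤ max n i := by
  unfold breakSeq
  split_ifs
  · exact le_max_right _ _
  · exact (hz n).trans (le_max_left _ _)

theorem ofFn_eq_append_cons {D : Type} (f : ℕ → D) {q n : ℕ} (h : q < n) :
    (List.ofFn fun k : Fin n => f k) = (List.ofFn fun k : Fin q => f k) ++
      f q :: List.ofFn fun k : Fin (n - 1 - q) => f (q + 1 + k) := by
  refine List.ext_getElem (by simp; omega) fun k h₁ h₂ => ?_
  simp only [List.getElem_ofFn, List.getElem_append, List.getElem_cons, List.length_ofFn]
  split_ifs with h₃ h₄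
  · rfl
  · congr 1; omega
  · congr 1; omega

theorem ofFn_eq_append_replicate {D : Type} (f : ℕ → D) (x : D) {n : ℕ} (h : ∀ m ≥ n, f m = x)
    (N : ℕ) : (List.ofFn fun k : Fin (n + N) => f k) =
      (List.ofFn fun k : Fin n => f k) ++ List.replicate N x := by
  refine List.ext_getElem (by simp) fun k h₁ h₂ => ?_
  simp only [List.getElem_ofFn, List.getElem_append, List.getElem_replicate, List.length_ofFn]
  split_ifs with h₃
  · rfl
  · exact h k (by omega)

/-- If the family with common sequence `z` and breaks in `A` is in the frame at each of its breaks,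
then its prefix of length `n + 1` comes from the frame element at its last break. -/
theorem exists_last_break {d : ℕ∞} {hd : 2 ≤ d} {s : ℕ → Idx d → List (Idx d)}
    (hs : IsEffectiveFrame hd s) {z : Seqs d} {A : Set ℕ} (hA : ∀ x ∈ A, Realizes s z A x)
    (n : ℕ) : ∃ q ≤ n, Realizes s z A q ∧ (q = 0 ∨ q ∈ A) ∧ ∀ x ∈ A, x ≤ n → x ≤ q := by
  induction n with
  | zero =>
    refine ⟨0, le_rfl, fun i => ?_, Or.inl rfl, fun x _ h => h⟩
    rw [List.ofFn_zero]
    exact List.eq_nil_of_length_eq_zero (hs.length_eq 0 i)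
  | succ n ih =>
    by_cases h : n + 1 ∈ A
    · exact ⟨n + 1, le_rfl, hA _ h, Or.inr h, fun x _ h => h⟩
    · obtain ⟨q, hq, hr, hqA, hlast⟩ := ih
      refine ⟨q, by omega, hr, hqA, fun x hx hxn => hlast x hx ?_⟩
      rcases Nat.lt_or_eq_of_le hxn with h' | rfl
      · omega
      · exact absurd hx h

/-- The decomposition of a prefix as `s q i`, then `i`, then a sequence that is common to all
coordinates. -/
theorem exists_prefix_eq {d : ℕ∞} {hd : 2 ≤ d} {s : ℕ → Idx d → List (Idx d)}
    (hs : IsEffectiveFrame hd s) {z : Seqs d} {A : Set ℕ} (hA : ∀ x ∈ A, Realizes s z A x)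
    {n : ℕ} (hn : 0 < n) : ∃ q < n, ∃ t : List (Idx d), t.length = n - 1 - q ∧
      ∀ i, (List.ofFn fun k : Fin n => breakSeq z A i k) = s q i ++ i :: t := by
  obtain ⟨q, hq, hr, hqA, hlast⟩ := exists_last_break hs hA (n - 1)
  refine ⟨q, by omega, List.ofFn fun k : Fin (n - 1 - q) => z (q + 1 + k), by simp, fun i => ?_⟩
  rw [ofFn_eq_append_cons (breakSeq z A i) (show q < n by omega), hr i]
  congr 2
  · exact if_pos hqA
  · congr 1
    funext k
    refine if_neg ?_
    rintro (h | h)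
    · omega
    · have := hlast _ h (by omega)
      omega

theorem breakSeq_mem_branches {d : ℕ∞} {hd : 2 ≤ d} {s : ℕ → Idx d → List (Idx d)}
    (hs : IsEffectiveFrame hd s) {z : Seqs d} (hz : ∀ m, (z m : ℕ) ≤ m) {A : Set ℕ}
    (hA : ∀ x ∈ A, Realizes s z A x) : breakSeq z A ∈ branches (frameTree hd s) := by
  intro n
  rcases Nat.eq_zero_or_pos n with rfl | hn
  · exact Or.inl fun i => List.ofFn_zero
  · obtain ⟨q, -, t, -, ht⟩ := exists_prefix_eq hs hA hn
    refine Or.inr ⟨⟨q, t, ht⟩, fun k hk => ?_⟩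
    rw [List.getElem_ofFn]
    simpa [Idx.zero] using breakSeq_le hz A (Idx.zero (zero_lt hd)) k

/-- A family that is in the frame at each of its breaks can be prolonged by zeros up to a frame
element whose length has prescribed coordinates. -/
theorem exists_realizes_ge {d : ℕ∞} {hd : 2 ≤ d} {s : ℕ → Idx d → List (Idx d)}
    (hs : IsEffectiveFrame hd s) {z : Seqs d} {A : Set ℕ} (hA : ∀ x ∈ A, Realizes s z A x)
    {n : ℕ} (hn : 0 < n) (hz : ∀ m ≥ n, z m = Idx.zero (zero_lt hd)) (hAn : ∀ x ∈ A, x < n)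
    (p r : ℕ) : ∃ l ≥ n, Realizes s z A l ∧ fstCoord (l - 1) = p ∧
      fstCoord (sndCoord (l - 1)) = r := by
  obtain ⟨q, hq, t, htl, ht⟩ := exists_prefix_eq hs hA hn
  obtain ⟨N, ⟨l, hl⟩, hp, hr⟩ := hs.extend p q r t
  have hlen : (s q (Idx.zero (zero_lt hd)) ++ Idx.zero (zero_lt hd) ::
      (t ++ List.replicate N (Idx.zero (zero_lt hd)))).length = n + N := by
    simp only [List.length_append, List.length_cons, List.length_replicate, hs.length_eq, htl]
    omega
  have hln : l = n + N := by
    rw [← hs.length_eq l (Idx.zero (zero_lt hd)), hl, hlen]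
  subst hln
  rw [hlen] at hp hr
  refine ⟨n + N, by omega, fun i => ?_, hp, hr⟩
  rw [ofFn_eq_append_replicate (breakSeq z A i) (Idx.zero (zero_lt hd)), ht i, hl]
  · simp
  · intro m hm
    rw [← hz m hm]
    refine if_neg ?_
    rintro (h | h)
    · omega
    · exact absurd (hAn m h) (by omega)

/-! ### The binary tree of nodes -/

/-- The code of the restriction of `α` to `m`, in bijective base two. -/
def node (α : ℕ → Bool) : ℕ → ℕ
  | 0 => 0
  | m + 1 => 2 * node α m + bif α m then 2 else 1

theorem node_strictMono (α : ℕ → Bool) : StrictMono (node α) := by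
  refine strictMono_nat_of_lt_succ fun m => ?_
  rw [node]
  cases α m <;> simp <;> omega

theorem node_congr {α α' : ℕ → Bool} {m : ℕ} (h : ∀ k < m, α k = α' k) :
    node α m = node α' m := by
  induction m with
  | zero => rfl
  | succ m ih => rw [node, node, ih fun k hk => h k (by omega), h m (by omega)]

theorem eq_of_node_eq {α α' : ℕ → Bool} {m m' : ℕ} (h : node α m = node α' m') :
    m = m' ∧ ∀ k < m, α k = α' k := by
  induction m generalizing m' with
  | zero =>
    cases m' with
    | zero => simp
    | succ m' =>
      rw [node, node] at h
      cases h' : α' m' <;> simp [h'] at h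
  | succ m ih =>
    cases m' with
    | zero =>
      rw [node, node] at h
      cases h' : α m <;> simp [h'] at h
    | succ m' =>
      rw [node, node] at h
      have h₁ : node α m = node α' m' ∧ α m = α' m' := by
        cases h' : α m <;> cases h'' : α' m' <;> simp [h', h''] at h ⊢ <;> omega
      obtain ⟨rfl, hk⟩ := ih h₁.1
      refine ⟨rfl, fun k hk' => ?_⟩
      rcases Nat.lt_succ_iff_lt_or_eq.1 hk' with h' | rfl
      · exact hk k h'
      · exact h₁.2

/-- The breaks of the restriction of `α` to `m`, where `b` attaches a position to each node: there
is one for each `m' < m` with `α m' = 1`. -/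
def breaksBelow (b : ℕ → ℕ) (α : ℕ → Bool) (m : ℕ) : Set ℕ :=
  {x | ∃ m' < m, α m' = true ∧ b (node α m') = x}

/-- The breaks attached to `α`, where `b` attaches a position to each node. -/
def breaks (b : ℕ → ℕ) (α : ℕ → Bool) : Set ℕ :=
  {x | ∃ m, α m = true ∧ b (node α m) = x}

theorem breaksBelow_congr {b b' : ℕ → ℕ} {α α' : ℕ → Bool} {m : ℕ} (h : ∀ k < m, α k = α' k)
    (hb : ∀ k < node α m, b k = b' k) : breaksBelow b α m = breaksBelow b' α' m := by
  ext x
  refine exists_congr fun m' => and_congr_right fun hm => ?_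
  rw [h m' hm, hb _ (node_strictMono α hm), node_congr fun k hk => h k (hk.trans hm)]

theorem mem_breaks_iff {b : ℕ → ℕ} {α : ℕ → Bool} {m x : ℕ}
    (hb : ∀ m' ≥ m, x < b (node α m')) : x ∈ breaks b α ↔ x ∈ breaksBelow b α m := by
  constructor
  · rintro ⟨m', hα, rfl⟩
    refine ⟨m', ?_, hα, rfl⟩
    by_contra h
    exact lt_irrefl _ (hb m' (not_lt.1 h))
  · rintro ⟨m', -, h⟩
    exact ⟨m', h⟩

/-! ### The generic construction -/

/-- A closed set that contains the `i`-th coordinates of the families whose common sequence `z`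
satisfies `z n ≤ n`. -/
def bounded {d : ℕ∞} (i : Idx d) : Set (Seqs d) := {β | ∀ n, (β n : ℕ) ≤ max n i}

/-- The prefix of length `n` of the `i`-th coordinate of the family with common sequence `z` and
breaks in `A` forces membership in `U`. -/
def Forced {d : ℕ∞} (U : Set (Seqs d)) (i : Idx d) (z : Seqs d) (A : Set ℕ) (n : ℕ) : Prop :=
  ∀ γ ∈ bounded i, (∀ m < n, γ m = breakSeq z A i m) → γ ∈ U

theorem Forced.mono {d : ℕ∞} {U : Set (Seqs d)} {i : Idx d} {z z' : Seqs d} {A : Set ℕ} {n n' : ℕ}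
    (h : Forced U i z A n) (hn : n ≤ n') (hz : ∀ m < n, z' m = z m) : Forced U i z' A n' :=
  fun γ hγ hm => h γ hγ fun m hmn =>
    (hm m (hmn.trans_le hn)).trans (breakSeq_congr (hz m hmn) Iff.rfl i)

/-- The common sequence `z` vanishes from `n` on, and satisfies `z m ≤ m`. -/
def IsFiniteSeq {d : ℕ∞} (hd : 2 ≤ d) (z : Seqs d) (n : ℕ) : Prop :=
  (∀ m, (z m : ℕ) ≤ m) ∧ ∀ m ≥ n, z m = Idx.zero (zero_lt hd)

theorem IsFiniteSeq.mono {d : ℕ∞} {hd : 2 ≤ d} {z : Seqs d} {n n' : ℕ} (h : IsFiniteSeq hd z n)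
    (hn : n ≤ n') : IsFiniteSeq hd z n' :=
  ⟨h.1, fun m hm => h.2 m (hn.trans hm)⟩

/-- Below `n` the coordinate `i` is already determined, and from `n` on it has no break, so a
modification of it beyond `n` can be copied into the common sequence. -/
theorem exists_forced {d : ℕ∞} {hd : 2 ≤ d} {U : Set (Seqs d)} {i : Idx d}
    (hU : PrefixDense (bounded i) U) {z : Seqs d} {n : ℕ} (hz : IsFiniteSeq hd z n) (hn : 0 < n)
    (hi : (i : ℕ) ≤ n) {A : Set ℕ} (hA : ∀ x ∈ A, x < n) :
    ∃ z' n', n ≤ n' ∧ (∀ m < n, z' m = z m) ∧ IsFiniteSeq hd z' n' ∧ Forced U i z' A n' := by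
  obtain ⟨β, hβ, hβz, n', hn', hβU⟩ := hU (breakSeq z A i) (breakSeq_le hz.1 A i) n
  refine ⟨fun m => if m < n then z m else if m < n' then β m else Idx.zero (zero_lt hd), n', hn',
    fun m hm => if_pos hm, ⟨fun m => ?_, fun m hm => ?_⟩, fun γ hγ h => hβU γ hγ fun m hm => ?_⟩
  · dsimp only
    split_ifs with h₁ h₂
    · exact hz.1 m
    -- beyond `n ≥ i`, the bound `max m i` is `m`
    · exact (hβ m).trans (max_le le_rfl (by omega))
    · exact Nat.zero_le m
  · simp only [if_neg (show ¬ m < n by omega), if_neg (show ¬ m < n' by omega)]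
  · rw [h m hm]
    by_cases hmn : m < n
    · rw [hβz m hmn]
      exact breakSeq_congr (if_pos hmn) Iff.rfl i
    · have : ¬ (m = 0 ∨ m ∈ A) := by
        rintro (h' | h')
        · omega
        · exact hmn (hA m h')
      simp only [breakSeq, if_neg this, if_neg hmn, if_pos hm]

theorem exists_forced_of_finite {d : ℕ∞} {hd : 2 ≤ d} {O : Idx d → ℕ → Set (Seqs d)}
    (hO : ∀ i k, PrefixDense (bounded i) (O i k)) {z : Seqs d} {n : ℕ} (hz : IsFiniteSeq hd z n)
    (hn : 0 < n) {S : Set (Idx d × ℕ × Set ℕ)} (hS : S.Finite)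
    (hSn : ∀ x ∈ S, (x.1 : ℕ) ≤ n ∧ ∀ y ∈ x.2.2, y < n) :
    ∃ z' n', n ≤ n' ∧ (∀ m < n, z' m = z m) ∧ IsFiniteSeq hd z' n' ∧
      ∀ x ∈ S, Forced (O x.1 x.2.1) x.1 z' x.2.2 n' := by
  induction S, hS using Set.Finite.induction_on with
  | empty => exact ⟨z, n, le_rfl, fun _ _ => rfl, hz, fun x hx => hx.elim⟩
  | @insert a S _ _ ih =>
    obtain ⟨z₁, n₁, hn₁, hz₁, hf₁, hS₁⟩ := ih fun x hx => hSn x (mem_insert_of_mem _ hx)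
    obtain ⟨ha, haA⟩ := hSn a (mem_insert _ _)
    obtain ⟨z₂, n₂, hn₂, hz₂, hf₂, ha₂⟩ := exists_forced (hO a.1 a.2.1) hf₁ (by omega)
      (ha.trans hn₁) fun x hx => (haA x hx).trans_le hn₁
    refine ⟨z₂, n₂, by omega, fun m hm => ?_, hf₂, ?_⟩
    · rw [hz₂ m (by omega), hz₁ m hm]
    · rintro x (rfl | hx)
      · exact ha₂
      · exact (hS₁ x hx).mono hn₂ hz₂

/-- The break attached to the node of length `m` of `α` is at a frame element, and the coordinates
of its predecessor agree with those of `m`. -/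
def IsBreakAt {d : ℕ∞} (s : ℕ → Idx d → List (Idx d)) (z : Seqs d) (b : ℕ → ℕ) (α : ℕ → Bool)
    (m x : ℕ) : Prop :=
  Realizes s z (breaksBelow b α m) x ∧ fstCoord (x - 1) = fstCoord m ∧
    fstCoord (sndCoord (x - 1)) = fstCoord (sndCoord m)

/-- A finite approximation: the prefix of length `n` of the common sequence `z`, and the positions
`b k` attached to the nodes `k < j`. -/
structure Approx {d : ℕ∞} (hd : 2 ≤ d) (s : ℕ → Idx d → List (Idx d)) (j n : ℕ) (z : Seqs d)
    (b : ℕ → ℕ) : Prop where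
  pos : 0 < n
  le : j ≤ n
  fin : IsFiniteSeq hd z n
  pos_break : ∀ k < j, 0 < b k
  break_lt : ∀ k < j, b k < n
  zero_break : ∀ k < j, z (b k) = Idx.zero (zero_lt hd)
  mono : ∀ k < j, ∀ k' < k, b k' < b k
  isBreakAt : ∀ α m, node α m < j → IsBreakAt s z b α m (b (node α m))

/-- The node `j` receives a position beyond `n`, and the prefix is prolonged so as to decide the
sets `O i k` with `i, k ≤ j` for all sets of breaks among the positions chosen so far. -/
theorem Approx.exists_succ {d : ℕ∞} {hd : 2 ≤ d} {s : ℕ → Idx d → List (Idx d)}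
    (hs : IsEffectiveFrame hd s) {O : Idx d → ℕ → Set (Seqs d)}
    (hO : ∀ i k, PrefixDense (bounded i) (O i k)) {j n : ℕ} {z : Seqs d} {b : ℕ → ℕ}
    (h : Approx hd s j n z b) :
    ∃ n' z' b', Approx hd s (j + 1) n' z' b' ∧ n ≤ n' ∧ (∀ m < n, z' m = z m) ∧
      (∀ k < j, b' k = b k) ∧ n ≤ b' j ∧
      ∀ (i : Idx d) k A, (i : ℕ) ≤ j → k ≤ j → A ⊆ b' '' Iic j → Forced (O i k) i z' A n' := by
  have hl : ∃ l ≥ n, ∀ α m, node α m = j → IsBreakAt s z b α m l := by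
    by_cases hj : ∃ α m, node α m = j
    · obtain ⟨α, m, hα⟩ := hj
      have hlt : ∀ m' < m, node α m' < j := fun m' hm' => hα ▸ node_strictMono α hm'
      have hA : ∀ x ∈ breaksBelow b α m, Realizes s z (breaksBelow b α m) x := by
        rintro _ ⟨m', hm', -, rfl⟩
        refine (h.isBreakAt α m' (hlt m' hm')).1.congr (fun _ _ => rfl) fun y hy => ?_
        constructor
        · rintro ⟨m'', hm'', hx⟩
          exact ⟨m'', hm''.trans hm', hx⟩
        · rintro ⟨m'', hm'', hαm'', rfl⟩
          refine ⟨m'', ?_, hαm'', rfl⟩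
          by_contra hge
          rcases Nat.lt_or_eq_of_le (not_lt.1 hge) with h' | rfl
          · exact lt_asymm hy (h.mono _ (hlt _ hm'') _ (node_strictMono α h'))
          · exact lt_irrefl _ hy
      have hAn : ∀ x ∈ breaksBelow b α m, x < n := by
        rintro _ ⟨m', hm', -, rfl⟩
        exact h.break_lt _ (hlt m' hm')
      obtain ⟨l, hln, hl, hl'⟩ := exists_realizes_ge hs hA h.pos h.fin.2 hAn (fstCoord m)
        (fstCoord (sndCoord m))
      refine ⟨l, hln, fun α' m' hα' => ?_⟩
      obtain ⟨rfl, hk⟩ := eq_of_node_eq (hα.trans hα'.symm)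
      exact ⟨breaksBelow_congr hk (fun _ _ => rfl) ▸ hl, hl'⟩
    · exact ⟨n, le_rfl, fun α m hα => absurd ⟨α, m, hα⟩ hj⟩
  obtain ⟨l, hln, hl⟩ := hl
  let b' := Function.update b j l
  have hb' : ∀ k < j, b' k = b k := fun k hk => Function.update_of_ne hk.ne _ _
  have hb'j : b' j = l := Function.update_self _ _ _
  have hlt : ∀ k ≤ j, b' k ≤ l := fun k hk => by
    rcases Nat.lt_or_eq_of_le hk with hk | rfl
    · rw [hb' k hk]
      exact (h.break_lt k hk).le.trans hln
    · exact hb'j.le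
  let S : Set (Idx d × ℕ × Set ℕ) := {i : Idx d | (i : ℕ) ≤ j} ×ˢ Iic j ×ˢ {A | A ⊆ b' '' Iic j}
  have hS : S.Finite :=
    ((finite_Iic j).preimage Subtype.val_injective.injOn).prod
      ((finite_Iic j).prod ((finite_Iic j).image b').finite_subsets)
  have hjn := h.le
  have hpos := h.pos
  obtain ⟨z', n', hn', hz', hf', hS'⟩ := exists_forced_of_finite hO
    (h.fin.mono (show n ≤ l + 1 by omega)) (by omega) hS <| by
      rintro ⟨i, k, A⟩ ⟨hi, -, hA⟩
      refine ⟨le_trans hi (by omega), fun y hy => ?_⟩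
      obtain ⟨k', hk', rfl⟩ := hA hy
      exact Nat.lt_succ_of_le (hlt k' hk')
  refine ⟨n', z', b', ⟨by omega, by omega, hf', ?_, ?_, ?_, ?_, ?_⟩, by omega,
    fun m hm => hz' m (by omega), hb', hb'j ▸ hln,
    fun i k A hi hk hA => hS' (i, k, A) ⟨hi, hk, hA⟩⟩
  · intro k hk
    rcases Nat.lt_succ_iff_lt_or_eq.1 hk with hk | rfl
    · rw [hb' k hk]
      exact h.pos_break k hk
    · rw [hb'j]
      omega
  · intro k hk
    have := hlt k (by omega)
    omega
  · intro k hk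
    rw [hz' _ (Nat.lt_succ_of_le (hlt k (by omega)))]
    rcases Nat.lt_succ_iff_lt_or_eq.1 hk with hk | rfl
    · rw [hb' k hk]
      exact h.zero_break k hk
    · rw [hb'j]
      exact h.fin.2 l hln
  · intro k hk k' hk'
    rw [hb' k' (by omega)]
    rcases Nat.lt_succ_iff_lt_or_eq.1 hk with hk | rfl
    · rw [hb' k hk]
      exact h.mono k hk k' hk'
    · rw [hb'j]
      exact (h.break_lt k' hk').trans_le hln
  · intro α m hα
    have hx : b' (node α m) ≤ l := hlt _ (by omega)
    have hold : IsBreakAt s z b α m (b' (node α m)) := by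
      rcases Nat.lt_succ_iff_lt_or_eq.1 hα with hk | hk
      · rw [hb' _ hk]
        exact h.isBreakAt α m hk
      · rw [hk, hb'j]
        exact hl α m hk
    refine ⟨?_, hold.2⟩
    rw [breaksBelow_congr (b := b') (b' := b) (fun _ _ => rfl) fun k hk => hb' k (by omega)]
    exact hold.1.congr (fun y hy => (hz' y (by omega)).symm) fun _ _ => Iff.rfl

/-- A common sequence `z` and positions attached to the nodes such that all the families with
breaks among these positions are generic, and the families with breaks attached to the nodes along
a sequence `α` are in the frame at each of their breaks. -/
theorem exists_generic {d : ℕ∞} {hd : 2 ≤ d} {s : ℕ → Idx d → List (Idx d)}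
    (hs : IsEffectiveFrame hd s) {O : Idx d → ℕ → Set (Seqs d)}
    (hO : ∀ i k, PrefixDense (bounded i) (O i k)) :
    ∃ (z : Seqs d) (b : ℕ → ℕ), (∀ m, (z m : ℕ) ≤ m) ∧ StrictMono b ∧ (∀ k, 0 < b k) ∧
      (∀ k, z (b k) = Idx.zero (zero_lt hd)) ∧
      (∀ α m, IsBreakAt s z b α m (b (node α m))) ∧
      ∀ A ⊆ range b, ∀ i k, breakSeq z A i ∈ O i k := by
  have step : ∀ (j : ℕ) (p : ℕ × Seqs d × (ℕ → ℕ)), ∃ p' : ℕ × Seqs d × (ℕ → ℕ),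
      Approx hd s j p.1 p.2.1 p.2.2 → Approx hd s (j + 1) p'.1 p'.2.1 p'.2.2 ∧ p.1 ≤ p'.1 ∧
      (∀ m < p.1, p'.2.1 m = p.2.1 m) ∧ (∀ k < j, p'.2.2 k = p.2.2 k) ∧ p.1 ≤ p'.2.2 j ∧
      ∀ (i : Idx d) k A, (i : ℕ) ≤ j → k ≤ j → A ⊆ p'.2.2 '' Iic j →
        Forced (O i k) i p'.2.1 A p'.1 := by
    rintro j ⟨n, z, b⟩
    by_cases h : Approx hd s j n z b
    · obtain ⟨n', z', b', h'⟩ := h.exists_succ hs hO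
      exact ⟨(n', z', b'), fun _ => h'⟩
    · exact ⟨(n, z, b), fun h' => absurd h' h⟩
  choose g hg using step
  let f : ℕ → ℕ × Seqs d × (ℕ → ℕ) := fun j =>
    Nat.rec (1, fun _ => Idx.zero (zero_lt hd), fun _ => 0) (fun j p => g j p) j
  have hf : ∀ j, Approx hd s j (f j).1 (f j).2.1 (f j).2.2 := by
    intro j
    induction j with
    | zero =>
      refine ⟨one_pos, zero_le_one, ⟨fun m => Nat.zero_le m, fun _ _ => rfl⟩, ?_, ?_, ?_, ?_, ?_⟩
      all_goals intros; omega
    | succ j ih => exact (hg j _ ih).1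
  have hfs := fun j => (hg j _ (hf j)).2
  have stable : ∀ j J, j ≤ J → (f j).1 ≤ (f J).1 ∧ (∀ m < (f j).1, (f J).2.1 m = (f j).2.1 m) ∧
      ∀ k < j, (f J).2.2 k = (f j).2.2 k := by
    intro j J hJ
    induction J, hJ using Nat.le_induction with
    | base => exact ⟨le_rfl, fun _ _ => rfl, fun _ _ => rfl⟩
    | succ J hJ ih =>
      obtain ⟨h₁, h₂, h₃, -⟩ := hfs J
      exact ⟨ih.1.trans h₁, fun m hm => (h₂ m (hm.trans_le ih.1)).trans (ih.2.1 m hm),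
        fun k hk => (h₃ k (hk.trans_le hJ)).trans (ih.2.2 k hk)⟩
  let z : Seqs d := fun m => (f (m + 1)).2.1 m
  let b : ℕ → ℕ := fun k => (f (k + 1)).2.2 k
  have hz : ∀ j, ∀ m < (f j).1, z m = (f j).2.1 m := fun j m hm => by
    rw [← (stable j (max j (m + 1)) (le_max_left _ _)).2.1 m hm]
    exact ((stable (m + 1) (max j (m + 1)) (le_max_right _ _)).2.1 m (hf (m + 1)).le).symm
  have hb : ∀ j, ∀ k < j, b k = (f j).2.2 k := fun j k hk =>
    ((stable (k + 1) j hk).2.2 k k.lt_succ_self).symm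
  have hblt : ∀ j, ∀ k < j, b k < (f j).1 := fun j k hk => by
    rw [hb j k hk]
    exact (hf j).break_lt k hk
  refine ⟨z, b, fun m => (hf (m + 1)).fin.1 m, strictMono_nat_of_lt_succ fun k => ?_,
    fun k => (hf (k + 1)).pos_break k k.lt_succ_self, fun k => ?_, fun α m => ?_, ?_⟩
  · rw [hb (k + 2) k (by omega), hb (k + 2) (k + 1) (by omega)]
    exact (hf (k + 2)).mono (k + 1) (by omega) k (by omega)
  · rw [hz (k + 1) _ (hblt _ k k.lt_succ_self)]
    exact (hf (k + 1)).zero_break k k.lt_succ_self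
  · have h := (hf (node α m + 1)).isBreakAt α m (Nat.lt_succ_self _)
    refine ⟨?_, h.2⟩
    rw [breaksBelow_congr (b := b) (fun _ _ => rfl)
      fun k hk => hb (node α m + 1) k (hk.trans (Nat.lt_succ_self _))]
    refine h.1.congr (fun y hy => (hz (node α m + 1) y ?_).symm) fun _ _ => Iff.rfl
    exact hy.trans (hblt _ _ (Nat.lt_succ_self _))
  · intro A hA i k
    let j := max (i : ℕ) k
    have hforced := (hfs j).2.2.2.2 i k (A ∩ (f (j + 1)).2.2 '' Iic j) (le_max_left _ _)
      (le_max_right _ _) inter_subset_right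
    refine hforced _ (breakSeq_le (fun m => (hf (m + 1)).fin.1 m) A i) fun m hm => ?_
    suffices hmem : m ∈ A → m ∈ (f (j + 1)).2.2 '' Iic j from
      breakSeq_congr (hz (j + 1) m hm) (iff_self_and.2 hmem) i
    intro h
    obtain ⟨k', rfl⟩ := hA h
    have hk' : k' ≤ j := by
      by_contra hlt
      -- the position attached to a later node lies beyond the prefix
      have := (hfs k').2.2.2.1
      have := (stable (j + 1) k' (by omega)).1
      have : b k' < (f (j + 1)).1 := hm
      have : b k' = (g k' (f k')).2.2 k' := rfl
      omega
    exact ⟨k', hk', (hb (j + 1) k' (Nat.lt_succ_of_le hk')).symm⟩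

/-! ### The coding of pairs and sequences -/

theorem triangle_succ (m : ℕ) : triangle (m + 1) = triangle m + (m + 1) :=
  Finset.sum_range_succ _ _

theorem triangle_mono : Monotone triangle :=
  monotone_nat_of_le_succ fun m => by rw [triangle_succ]; omega

theorem le_triangle (m : ℕ) : m ≤ triangle m := by
  cases m with
  | zero => exact Nat.zero_le _
  | succ m => rw [triangle_succ]; omega

theorem triangle_bigM_le (l : ℕ) : triangle (bigM l) ≤ l :=
  Nat.findGreatest_spec (P := fun m => triangle m ≤ l) (Nat.zero_le l) (by simp [triangle])

theorem lt_triangle_bigM_succ (l : ℕ) : l < triangle (bigM l + 1) := by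
  by_contra h
  have h' := not_lt.1 h
  have hle : bigM l + 1 ≤ l := (le_triangle _).trans h'
  exact Nat.findGreatest_is_greatest (P := fun m => triangle m ≤ l) (Nat.lt_succ_self _) hle h'

theorem pairCode_fstCoord_sndCoord (l : ℕ) : pairCode (fstCoord l) (sndCoord l) = l := by
  have h₁ := triangle_bigM_le l
  have h₂ := lt_triangle_bigM_succ l
  rw [triangle_succ] at h₂
  have h : fstCoord l + sndCoord l = bigM l := by
    unfold fstCoord sndCoord
    omega
  rw [pairCode, h, sndCoord]
  omega

theorem fstCoord_pairCode (a p : ℕ) : fstCoord (pairCode a p) = a := by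
  have h₁ := triangle_bigM_le (pairCode a p)
  have h₂ := lt_triangle_bigM_succ (pairCode a p)
  have hM : bigM (pairCode a p) = a + p := by
    refine le_antisymm ?_ ?_ <;> by_contra h
    · have := triangle_mono (show a + p + 1 ≤ bigM (pairCode a p) by omega)
      rw [triangle_succ] at this
      rw [pairCode] at this h₁
      omega
    · have := triangle_mono (show bigM (pairCode a p) + 1 ≤ a + p by omega)
      have : triangle (a + p) ≤ pairCode a p := Nat.le_add_right _ _
      omega
  rw [fstCoord, hM, pairCode]
  omega

/-- The integers with the same first coordinate as the code of `um` are the codes of the `um'`. -/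
theorem exists_seqCode_eq (u : List ℕ) (m : ℕ) {x : ℕ}
    (h : fstCoord (seqCode (u ++ [m])) = fstCoord x) : ∃ m', seqCode (u ++ [m']) = x := by
  cases u with
  | nil => exact ⟨x, rfl⟩
  | cons a u =>
    have hc : ∀ m, seqCode (a :: u ++ [m]) = pairCode (seqCode (a :: u)) m := fun m => by
      simp [seqCode]
    refine ⟨sndCoord x, ?_⟩
    rw [hc, fstCoord_pairCode] at h
    rw [hc, h, pairCode_fstCoord_sndCoord]

/-- The order isomorphism in the definition of `Linked` implies the conditions on codes. -/
theorem linked_of_orderIso {α δ : ℕ → Bool}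
    (B : {m : ℕ // α m = true} ≃o {m : ℕ // δ (m + 1) = true})
    (hB : ∀ m : {m : ℕ // α m = true}, fstCoord m.1 = fstCoord (B m).1 ∧
      fstCoord (sndCoord m.1) = fstCoord (sndCoord (B m).1)) : Linked α δ := by
  refine ⟨fun u m => ⟨fun h => ?_, fun h => ?_⟩, B, hB⟩
  · obtain ⟨m', hm'⟩ := exists_seqCode_eq u m (hB ⟨_, h⟩).1
    exact ⟨m', hm' ▸ (B ⟨_, h⟩).2⟩
  · have := (hB (B.symm ⟨_, h⟩)).1
    rw [B.apply_symm_apply] at this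
    obtain ⟨m', hm'⟩ := exists_seqCode_eq u m this.symm
    exact ⟨m', hm' ▸ (B.symm ⟨_, h⟩).2⟩

/-! ### Generic families of branches -/

theorem realizes_breaks {d : ℕ∞} {s : ℕ → Idx d → List (Idx d)} {z : Seqs d} {b : ℕ → ℕ}
    (hb : StrictMono b) {α : ℕ → Bool} (h : ∀ m, IsBreakAt s z b α m (b (node α m))) :
    ∀ x ∈ breaks b α, Realizes s z (breaks b α) x := by
  rintro _ ⟨m, -, rfl⟩
  refine (h m).1.congr (fun _ _ => rfl) fun y hy => (mem_breaks_iff fun m' hm' => ?_).symm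
  exact hy.trans_le (hb.monotone ((node_strictMono α).monotone hm'))

/-- Positions are at least the length of their node, so whether `n` is a break of `α` depends only on
the first `n + 1` values of `α`. -/
theorem continuous_breakSeq_breaks {d : ℕ∞} (z : Seqs d) {b : ℕ → ℕ} (hb : StrictMono b)
    (i : Idx d) : Continuous fun α => breakSeq z (breaks b α) i := by
  refine continuous_pi fun n => continuous_of_finite_dependence (n + 1) fun α α' h => ?_
  have key : ∀ α : ℕ → Bool, n ∈ breaks b α ↔ n ∈ breaksBelow b α (n + 1) := fun α =>
    mem_breaks_iff fun m' hm' =>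
      (Nat.lt_of_succ_le hm').trans_le (((node_strictMono α).le_apply).trans hb.le_apply)
  refine breakSeq_congr rfl ?_ i
  rw [key, key, breaksBelow_congr h fun _ _ => rfl]

theorem linked_symDiff_breakSeq {d : ℕ∞} {hd : 2 ≤ d} {s : ℕ → Idx d → List (Idx d)} {z : Seqs d}
    {b : ℕ → ℕ} (hb : StrictMono b) (hpos : ∀ k, 0 < b k)
    (hz : ∀ k, z (b k) = Idx.zero (zero_lt hd)) {α : ℕ → Bool}
    (h : ∀ m, IsBreakAt s z b α m (b (node α m))) :
    Linked α (symDiff z (breakSeq z (breaks b α) (Idx.one (one_lt hd)))) := by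
  have hδ : ∀ x, symDiff z (breakSeq z (breaks b α) (Idx.one (one_lt hd))) (x + 1) = true ↔
      x + 1 ∈ breaks b α := by
    intro x
    by_cases hx : x + 1 ∈ breaks b α
    · obtain ⟨m, -, hm⟩ := id hx
      have : z (x + 1) = Idx.zero (zero_lt hd) := hm ▸ hz _
      simp [symDiff, breakSeq, hx, this, Idx.zero, Idx.one]
    · simp [symDiff, breakSeq, hx]
  have hsub : ∀ m, b (node α m) - 1 + 1 = b (node α m) := fun m => Nat.sub_add_cancel (hpos _)
  let B : {m : ℕ // α m = true} → {m : ℕ //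
      symDiff z (breakSeq z (breaks b α) (Idx.one (one_lt hd))) (m + 1) = true} := fun m =>
    ⟨b (node α m.1) - 1, (hδ _).2 ⟨m.1, m.2, (hsub m.1).symm⟩⟩
  have hB : StrictMono B := by
    intro m m' hmm'
    have h₁ : b (node α m.1) < b (node α m'.1) := hb (node_strictMono α hmm')
    have h₂ := hsub m.1
    have h₃ := hsub m'.1
    change b (node α m.1) - 1 < b (node α m'.1) - 1
    omega
  have hBs : Function.Surjective B := by
    rintro ⟨x, hx⟩
    obtain ⟨m, hm, hmx⟩ := (hδ x).1 hx
    refine ⟨⟨m, hm⟩, Subtype.ext ?_⟩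
    change b (node α m) - 1 = x
    omega
  exact linked_of_orderIso (hB.orderIsoOfSurjective B hBs) fun m =>
    ⟨(h m.1).2.1.symm, (h m.1).2.2.symm⟩

theorem breakSeq_zero {d : ℕ∞} {hd : 2 ≤ d} {z : Seqs d} (hz : ∀ m, (z m : ℕ) ≤ m) {A : Set ℕ}
    (hA : ∀ x ∈ A, z x = Idx.zero (zero_lt hd)) : breakSeq z A (Idx.zero (zero_lt hd)) = z := by
  funext n
  unfold breakSeq
  split_ifs with h
  · rcases h with rfl | h
    · exact Subtype.ext (Nat.le_zero.1 (hz 0)).symm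
    · exact (hA n h).symm
  · rfl

/-- Generic families of branches of the tree, with a constant first coordinate `z`, indexed by
`2^ω`, such that `α` is linked to the symmetric difference of the first two coordinates. -/
theorem exists_generic_branches {d : ℕ∞} {hd : 2 ≤ d} {s : ℕ → Idx d → List (Idx d)}
    (hs : IsEffectiveFrame hd s) {O : Idx d → ℕ → Set (Seqs d)}
    (hO : ∀ i k, PrefixDense (bounded i) (O i k)) :
    ∃ (z : Seqs d) (F : (ℕ → Bool) → Idx d → Seqs d),
      (∀ i, Continuous fun α => F α i) ∧ (∀ α i, F α i ∈ bounded i) ∧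
      (∀ α i k, F α i ∈ O i k) ∧ (∀ α, F α ∈ branches (frameTree hd s)) ∧
      (∀ α, F α (Idx.zero (zero_lt hd)) = z) ∧
      ∀ α, Linked α (symDiff z (F α (Idx.one (one_lt hd)))) := by
  obtain ⟨z, b, hz, hb, hpos, hz0, hbr, hgen⟩ := exists_generic hs hO
  refine ⟨z, fun α => breakSeq z (breaks b α), continuous_breakSeq_breaks z hb,
    fun α i => breakSeq_le hz _ i, fun α => hgen _ ?_,
    fun α => breakSeq_mem_branches hs hz (realizes_breaks hb (hbr α)), fun α => ?_,
    fun α => linked_symDiff_breakSeq (hd := hd) hb hpos hz0 (hbr α)⟩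
  · rintro _ ⟨m, -, rfl⟩
    exact mem_range_self _
  · refine breakSeq_zero (hd := hd) hz ?_
    rintro _ ⟨m, -, rfl⟩
    exact hz0 _

/-- For finer Polish topologies on the factors, a family of branches as above that is continuous
for these topologies. -/
theorem exists_continuous_branches {d : ℕ∞} {hd : 2 ≤ d} {s : ℕ → Idx d → List (Idx d)}
    (hs : IsEffectiveFrame hd s) {τ : Idx d → TopologicalSpace (Seqs d)}
    (hτ : ∀ i, τ i ≤ Pi.topologicalSpace ∧ @PolishSpace (Seqs d) (τ i)) :
    ∃ F : (ℕ → Bool) → Idx d → Seqs d,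
      @Continuous _ _ _ (@Pi.topologicalSpace (Idx d) (fun _ => Seqs d) τ) F ∧
      (∀ α, F α ∈ branches (frameTree hd s)) ∧
      ∀ C, IsCcs hd C → ∀ α, F α ∈ frameSet hd s C ↔ α ∈ C := by
  choose G hG hcont using fun i =>
    @exists_residual_continuous (Seqs d) (τ i) Pi.topologicalSpace (isZeroDimPolish_seqs d).1
      (hτ i).1 (hτ i).2 (bounded i)
  choose O hO hOG using fun i => exists_dense_of_mem_residual (hG i)
  obtain ⟨z, F, hFc, hFb, hFO, hFT, hFz, hFl⟩ := exists_generic_branches hs hO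
  refine ⟨F, ?_, hFT, fun C hC α => ?_⟩
  · exact @continuous_pi _ _ _ _ τ _ fun i =>
      hcont i _ _ (hFc i) fun α => hOG i _ (hFb α i) (hFO α i)
  · rw [hC z (fun α _ => F α (Idx.one (one_lt hd))) hFl α, frameSet]
    simp only [mem_ofPred_eq, hFT α, true_and, hFz α]

/-! ### The closed set of branches -/

/-- A description of the branches by closed conditions. For each `n`, the index `l` of the frame
element ranges over a finite set, and the common tail is read off from the first coordinate. -/
theorem mem_branches_iff {d : ℕ∞} {hd : 2 ≤ d} {s : ℕ → Idx d → List (Idx d)}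
    (hs : IsEffectiveFrame hd s) {α : Idx d → Seqs d} :
    α ∈ branches (frameTree hd s) ↔ (∀ n, (α (Idx.zero (zero_lt hd)) n : ℕ) ≤ n) ∧
      ∀ n > 0, ∃ l < n, ∀ i, (List.ofFn fun k : Fin l => α i k) = s l i ∧ α i l = i ∧
        (fun k : Fin (n - 1 - l) => α i (l + 1 + k)) =
          fun k : Fin (n - 1 - l) => α (Idx.zero (zero_lt hd)) (l + 1 + k) := by
  constructor
  · intro h
    have h' : ∀ n > 0, _ := fun n hn => (h n).resolve_left fun h0 => by
      have := congrArg List.length (h0 (Idx.zero (zero_lt hd)))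
      simp at this
      omega
    refine ⟨fun n => ?_, fun n hn => ?_⟩
    · have := (h' (n + 1) n.succ_pos).2 n (by rw [List.length_ofFn]; exact n.lt_succ_self)
      rwa [List.getElem_ofFn] at this
    · obtain ⟨⟨l, t, ht⟩, -⟩ := h' n hn
      have hl : l < n := by
        have := congrArg List.length (ht (Idx.zero (zero_lt hd)))
        simp [hs.length_eq] at this
        omega
      have key : ∀ i, (List.ofFn fun k : Fin l => α i k) = s l i ∧ α i l = i ∧
          (List.ofFn fun k : Fin (n - 1 - l) => α i (l + 1 + k)) = t := fun i => by
        have hi := ht i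
        simp only at hi
        rw [ofFn_eq_append_cons (α i) hl] at hi
        obtain ⟨h₁, h₂⟩ := List.append_inj hi (by simp [hs.length_eq])
        exact ⟨h₁, List.cons_eq_cons.1 h₂⟩
      exact ⟨l, hl, fun i => ⟨(key i).1, (key i).2.1,
        List.ofFn_injective ((key i).2.2.trans (key _).2.2.symm)⟩⟩
  · rintro ⟨hb, h⟩ n
    rcases Nat.eq_zero_or_pos n with rfl | hn
    · exact Or.inl fun i => List.ofFn_zero
    · obtain ⟨l, hl, hi⟩ := h n hn
      refine Or.inr ⟨⟨l, List.ofFn fun k : Fin (n - 1 - l) =>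
        α (Idx.zero (zero_lt hd)) (l + 1 + k), fun i => ?_⟩, fun k hk => ?_⟩
      · obtain ⟨h₁, h₂, h₃⟩ := hi i
        simp only
        rw [ofFn_eq_append_cons (α i) hl, h₁, h₂, h₃]
      · simpa using hb k

theorem isClosed_branches {d : ℕ∞} {hd : 2 ≤ d} {s : ℕ → Idx d → List (Idx d)}
    (hs : IsEffectiveFrame hd s) : IsClosed (branches (frameTree hd s)) := by
  have : branches (frameTree hd s) =
      (⋂ n, {α : Idx d → Seqs d | (α (Idx.zero (zero_lt hd)) n : ℕ) ≤ n}) ∩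
        ⋂ n > 0, ⋃ l ∈ Iio n, ⋂ i,
          {α : Idx d → Seqs d | (List.ofFn fun k : Fin l => α i k) = s l i} ∩
          ({α | α i l = i} ∩ {α | (fun k : Fin (n - 1 - l) => α i (l + 1 + k)) =
            fun k : Fin (n - 1 - l) => α (Idx.zero (zero_lt hd)) (l + 1 + k)}) := by
    ext α
    rw [mem_branches_iff hs]
    simp
  rw [this]
  have hc : ∀ (i : Idx d) (n : ℕ), Continuous fun α : Idx d → Seqs d => α i n := by fun_prop
  refine IsClosed.inter (isClosed_iInter fun n => ?_) ?_
  · exact (isClosed_discrete {x : Idx d | (x : ℕ) ≤ n}).preimage (hc _ n)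
  · refine isClosed_iInter fun n => isClosed_iInter fun _ => ?_
    refine (finite_Iio n).isClosed_biUnion fun l _ => isClosed_iInter fun i => ?_
    refine IsClosed.inter ?_ (IsClosed.inter (isClosed_eq (hc i l) continuous_const)
      (isClosed_eq (by fun_prop) (by fun_prop)))
    exact (isClosed_discrete {v : Fin l → Idx d | List.ofFn v = s l i}).preimage
      (f := fun α : Idx d → Seqs d => fun k : Fin l => α i k) (by fun_prop)

theorem continuous_shift_symDiff {d : ℕ∞} (i j : Idx d) :
    Continuous fun α : Idx d → Seqs d => shift (symDiff (α i) (α j)) := by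
  refine continuous_pi fun m => ?_
  have : Continuous fun p : Idx d × Idx d => decide (p.1 ≠ p.2) := continuous_of_discreteTopology
  exact this.comp (f := fun α : Idx d → Seqs d => (α i (m + 1), α j (m + 1))) (by fun_prop)

theorem inClassOn_frameSet {d : ℕ∞} {hd : 2 ≤ d} {s : ℕ → Idx d → List (Idx d)}
    (hs : IsEffectiveFrame hd s) {Γ : PointClass} (hΓ : IsWadgeClass Γ) {C : Set (ℕ → Bool)}
    (hC : C ∈ Γ (ℕ → Bool)) : InClassOn Γ (branches (frameTree hd s)) (frameSet hd s C) := by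
  refine ⟨fun α h => h.1, hΓ.mem_of_wadgeLE ?_ isZeroDimPolish_cantor ?_ hC⟩
  · exact (IsZeroDimPolish.pi fun _ => isZeroDimPolish_seqs d).subtype (isClosed_branches hs)
  · refine ⟨fun α => shift (symDiff (α.1 (Idx.zero (zero_lt hd))) (α.1 (Idx.one (one_lt hd)))),
      (continuous_shift_symDiff _ _).comp continuous_subtype_val, ?_⟩
    ext α
    exact ⟨fun h => h.2, fun h => ⟨α.2, h⟩⟩

theorem isBorel_frameSet {d : ℕ∞} {hd : 2 ≤ d} {s : ℕ → Idx d → List (Idx d)}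
    (hs : IsEffectiveFrame hd s) {C : Set (ℕ → Bool)} (hC : IsBorel C) :
    IsBorel (frameSet hd s C) := by
  have h := hC.preimage (continuous_shift_symDiff (Idx.zero (zero_lt hd)) (Idx.one (one_lt hd)))
  have h' := isClosed_branches hs
  borelize (Idx d → Seqs d)
  exact h'.measurableSet.inter h

theorem disjoint_frameSet {d : ℕ∞} {hd : 2 ≤ d} (s : ℕ → Idx d → List (Idx d))
    {C₀ C₁ : Set (ℕ → Bool)} (h : Disjoint C₀ C₁) :
    Disjoint (frameSet hd s C₀) (frameSet hd s C₁) :=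
  disjoint_left.2 fun _ h₀ h₁ => disjoint_left.1 h h₀.2 h₁.2

/-! ### Potential Wadge classes -/

/-- The preimages of the sets in a Wadge class, for finer topologies on the factors, under a
continuous family of branches that reduces each ccs set `C` to `frameSet hd s C`. -/
theorem exists_branches_preimage_mem {d : ℕ∞} {hd : 2 ≤ d} {s : ℕ → Idx d → List (Idx d)}
    (hs : IsEffectiveFrame hd s) {Γ : PointClass} (hΓ : IsWadgeClass Γ)
    {τ : Idx d → TopologicalSpace (Seqs d)}
    (hτ : ∀ i, τ i ≤ Pi.topologicalSpace ∧ @IsZeroDimPolish (Seqs d) (τ i)) :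
    ∃ F : (ℕ → Bool) → Idx d → Seqs d,
      (∀ P ∈ @Γ (Idx d → Seqs d) (@Pi.topologicalSpace (Idx d) (fun _ => Seqs d) τ),
        F ⁻¹' P ∈ Γ (ℕ → Bool)) ∧
      (∀ α, F α ∈ branches (frameTree hd s)) ∧
      ∀ C, IsCcs hd C → ∀ α, F α ∈ frameSet hd s C ↔ α ∈ C := by
  obtain ⟨F, hF, hFT, hFC⟩ := exists_continuous_branches hs fun i => ⟨(hτ i).1, (hτ i).2.1⟩
  refine ⟨F, fun P hP => ?_, hFT, hFC⟩
  exact @IsWadgeClass.mem_of_wadgeLE Γ hΓ _ _ _ (@Pi.topologicalSpace _ _ τ)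
    isZeroDimPolish_cantor (@IsZeroDimPolish.pi _ _ _ τ fun i => (hτ i).2) _ _ ⟨F, hF, rfl⟩ hP

end PotWadge


theorem lemma2p6 (d : ℕ∞) (hd : 2 ≤ d) (s : ℕ → Idx d → List (Idx d))
    (hs : IsEffectiveFrame hd s) (Γ : PointClass) (hΓ : IsWadgeClass Γ)
    (hΓ' : ¬ IsSelfDual Γ) :
    (∀ C : Set (ℕ → Bool), IsCompleteFor Γ C → IsCcs hd C →
      InClassOn Γ (branches (frameTree hd s)) (frameSet hd s C) ∧
      IsBorel (frameSet hd s C) ∧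
      ¬ ∃ P : Set (Idx d → Seqs d), IsPot (dual Γ) P ∧
          Separates P (frameSet hd s C) (branches (frameTree hd s) \ frameSet hd s C)) ∧
    (∀ C₀ C₁ : Set (ℕ → Bool), C₀ ∈ Γ (ℕ → Bool) → C₁ ∈ Γ (ℕ → Bool) → Disjoint C₀ C₁ →
      IsCcs hd C₀ → IsCcs hd C₁ →
      (¬ ∃ D : Set (ℕ → Bool), D ∈ ambiguous Γ (ℕ → Bool) ∧ Separates D C₀ C₁) →
      InClassOn Γ (branches (frameTree hd s)) (frameSet hd s C₀) ∧
      InClassOn Γ (branches (frameTree hd s)) (frameSet hd s C₁) ∧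
      IsBorel (frameSet hd s C₀) ∧
      IsBorel (frameSet hd s C₁) ∧
      Disjoint (frameSet hd s C₀) (frameSet hd s C₁) ∧
      ¬ ∃ P : Set (Idx d → Seqs d), IsPot (ambiguous Γ) P ∧
          Separates P (frameSet hd s C₀) (frameSet hd s C₁)) := by
  refine ⟨fun C hC hccs => ⟨inClassOn_frameSet hs hΓ hC.1,
    isBorel_frameSet hs (hΓ.isBorel isZeroDimPolish_cantor hC.1), ?_⟩,
    fun C₀ C₁ hC₀ hC₁ hdisj hccs₀ hccs₁ hsep => ⟨inClassOn_frameSet hs hΓ hC₀,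
      inClassOn_frameSet hs hΓ hC₁, isBorel_frameSet hs (hΓ.isBorel isZeroDimPolish_cantor hC₀),
      isBorel_frameSet hs (hΓ.isBorel isZeroDimPolish_cantor hC₁), disjoint_frameSet s hdisj, ?_⟩⟩
  · rintro ⟨P, ⟨-, τ, hτ, hP⟩, hSP, hPS⟩
    obtain ⟨F, hF, hFT, hFC⟩ := exists_branches_preimage_mem hs hΓ hτ
    refine hΓ' (hC.isSelfDual hΓ isZeroDimPolish_cantor ?_)
    have : C = F ⁻¹' P := by
      ext α
      rw [← hFC C hccs α]
      refine ⟨fun h => hSP h, fun h => ?_⟩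
      by_contra h'
      exact Set.disjoint_left.1 hPS h ⟨hFT α, h'⟩
    rw [this]
    exact hF Pᶜ hP
  · rintro ⟨P, ⟨-, τ, hτ, hP, hPc⟩, hSP, hPS⟩
    obtain ⟨F, hF, hFT, hFC⟩ := exists_branches_preimage_mem hs hΓ hτ
    exact hsep ⟨F ⁻¹' P, ⟨hF P hP, hF Pᶜ hPc⟩, fun α h => hSP ((hFC C₀ hccs₀ α).2 h),
      Set.disjoint_left.2 fun α h h' => Set.disjoint_left.1 hPS h ((hFC C₁ hccs₁ α).2 h')⟩
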